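/- Let $\Sigma$ be a finite alphabet with $|\Sigma|\ge 2$. For $p\in\mathbb N$ and words $v,w\in\Sigma^*$ with $p\le |w|$, call $v$ a $p$-subsequence of $w$ if $v$ is a (scattered) subsequence of some factor of $w$ of length $p$, and call $v$ a minimal absent $p$-subsequence of $w$ if $v$ is not a $p$-subsequence of $w$ but every proper subsequence of $v$ (i.e., every subsequence of $v$ other than $v$ itself) is. The problem $\mathtt{pMAS}$ asks, for words $v,w$ over $\Sigma$ and an integer $p$ with $|v|\le p\le |w|$, whether $v$ is a minimal absent $p$-subsequence of $w$. A sliding-window algorithm for $\mathtt{pMAS}$ knows $v$ and the window size $p$ in advance (for each pair $(v,p)$ with $|v|\le p$ it is an arbitrary deterministic one-pass streaming algorithm, whose memory content is a bit string that is updated with each letter read, and which has no other access to the letters read before). It reads the letters of the stream one by one and, after each letter, as soon as at least $p$ letters have been read, it must report correctly, from its memory content alone, whether $v$ is a minimal absent $p$-subsequence of the word $w$ read so far. It uses at most $s(v,p)$ bits if, for all $v,p$ with $|v|\le p$, its memory content has length at most $s(v,p)$ at every time and on every stream. Then $\mathtt{pMAS}$ cannot be solved by a sliding-window algorithm using $o(\log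 p)$ bits: there is no sliding-window algorithm for $\mathtt{pMAS}$ over $\Sigma$ that uses at most $s(v,p)$ bits for some function $s$ such that, for every fixed $v\in\Sigma^*$, $s(v,p)=o(\log p)$ as $p\to\infty$. -/

import Mathlib

open Filter Asymptotics

namespace BoundedRange

variable {α : Type*}

/-- `v` is a `p`-subsequence of `w`: it is a subsequence of some factor `w[i+1 : i+p]` of `w` with
`i + 1 ≤ |w| - p + 1`. For `p ≤ |w|` these are exactly the factors of length `p`; for `p > |w|`
the only such range is, by the usual convention, `w` itself. -/
def IsPSubseq (p : ℕ) (v w : List α) : Prop :=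
  ∃ i : ℕ, i ≤ w.length - p ∧ v.Sublist ((w.drop i).take p)

/-- `v` is a minimal absent `p`-subsequence of `w`: it is not a `p`-subsequence of `w`, but all its
proper subsequences are. -/
def IsPMAS (p : ℕ) (v w : List α) : Prop :=
  ¬ IsPSubseq p v w ∧ ∀ u : List α, u.Sublist v → u ≠ v → IsPSubseq p u w

/-- A deterministic one-pass streaming algorithm over the alphabet `α`. Its memory content is a
bit string; each incoming letter updates the memory, and from the memory alone it can report a
yes/no answer at any time. The letters read so far are accessible only through the memory. -/
structure StreamingAlgorithm (α : Type*) where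
  /-- memory content before the first letter is read -/
  init : List Bool
  /-- memory content after one more letter is read -/
  update : List Bool → α → List Bool
  /-- the answer reported with the given memory content -/
  answer : List Bool → Bool

/-- The memory content after reading the stream `w` from left to right. -/
def StreamingAlgorithm.run (M : StreamingAlgorithm α) (w : List α) : List Bool :=
  w.foldl M.update M.init

/-- A sliding-window algorithm (fixed window size) for a problem with a pattern: the pattern `v`
and the window size `p` are known in advance, and for each of them we have a streaming algorithm
that reads the text. Nothing is assumed on how this streaming algorithm depends on `v` and `p`,
and storing `v` and `p` is not counted as memory. -/
abbrev SlidingWindowAlgorithm (α : Type*) := List α → ℕ → StreamingAlgorithm α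

namespace SlidingWindowAlgorithm

/-- The algorithm solves pMAS: for all `v` and `p` with `|v| ≤ p`, after each letter, as soon as
at least `p` letters were read, it reports whether `v` is a minimal absent `p`-subsequence of the
text `w` read so far. -/
def SolvesPMAS (A : SlidingWindowAlgorithm α) : Prop :=
  ∀ (v : List α) (p : ℕ), v.length ≤ p → ∀ w : List α, p ≤ w.length →
    ((A v p).answer ((A v p).run w) = true ↔ IsPMAS p v w)

/-- The algorithm uses at most `s v p` bits for the pattern `v` and the window size `p`: at every
time and on every stream, the memory content consists of at most `s v p` bits. -/
def UsesSpace (A : SlidingWindowAlgorithm α) (s : List α → ℕ → ℕ) : Prop :=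
  ∀ (v : List α) (p : ℕ), v.length ≤ p → ∀ w : List α, ((A v p).run w).length ≤ s v p

end SlidingWindowAlgorithm

end BoundedRange

namespace BoundedRange

open List

variable {α : Type*}

/-! Fooling-set argument with pattern `aa`. After `bᵖabᵏ` with `k < p`, the continuation `bʲa` makes
the answer depend on whether `k + j + 2 > p`, so varying `j` reveals `k`. Hence these `p` streams
leave distinct memory contents (`injective_run`), and counting bit strings gives `p ≤ 3 ^ s`, i.e.
`s = Ω(log p)`, for the fixed pattern `aa`. -/

/-- For `a ≠ b`, the word `aa` is a minimal absent `p`-subsequence of `bᵖ a bᵐ a` exactly when the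
two occurrences of `a` do not fit into a common window of length `p`. -/
theorem isPMAS_pair_iff {a b : α} (hab : a ≠ b) {p : ℕ} (hp : 2 ≤ p) (m : ℕ) :
    IsPMAS p [a, a] (replicate p b ++ a :: (replicate m b ++ [a])) ↔ p < m + 2 := by
  classical
  have hba : b ≠ a := hab.symm
  have hlen : (replicate p b ++ a :: (replicate m b ++ [a])).length - p = m + 2 := by
    simp only [length_append, length_replicate, length_cons, length_nil]; omega
  have hpair : ∀ l : List α, [a, a].Sublist l ↔ 2 ≤ l.count a := fun l => by
    rw [← replicate_sublist_iff]; rfl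
  constructor
  · rintro ⟨habs, -⟩
    by_contra! hm
    -- The last window, i.e. the suffix of length `p`, contains both `a`s.
    refine habs ⟨m + 2, hlen.ge, ?_⟩
    rw [hpair, drop_append_of_le_length (by simpa using hm), drop_replicate, take_of_length_le]
    · simp [count_replicate, hba]
    · simp only [length_append, length_replicate, length_cons, length_nil]; omega
  · intro hm
    refine ⟨?_, ?_⟩
    · rintro ⟨i, -, hsub⟩
      rw [hpair] at hsub
      -- A window starting at `i ≤ p` ends before the last `a`; a later one misses the first `a`.
      rcases le_or_gt i p with hi | hi
      · rw [drop_append_of_le_length (by simpa using hi), drop_replicate, ← cons_append,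
          ← append_assoc, take_append_of_le_length (by simp; omega)] at hsub
        have := hsub.trans ((take_sublist _ _).count_le a)
        simp [count_replicate, hba] at this
      · obtain ⟨j, rfl⟩ := Nat.exists_eq_add_of_lt hi
        rw [show p + j + 1 = (replicate p b).length + (j + 1) by simp; omega,
          drop_append, drop_eq_nil_of_le (by omega), Nat.add_sub_cancel_left, drop_succ_cons,
          nil_append] at hsub
        have := hsub.trans (((take_sublist _ _).trans (drop_sublist _ _)).count_le a)
        simp [count_replicate, hba] at this
    · intro u hu hne
      refine ⟨p, hlen.ge.trans' hm.le, ?_⟩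
      rw [drop_left' (by simp)]
      obtain ⟨q, rfl⟩ := Nat.exists_eq_add_of_lt (show 0 < p by omega)
      rw [take_succ_cons]
      obtain ⟨n, hn, rfl⟩ := sublist_replicate_iff.1 (show u.Sublist (replicate 2 a) from hu)
      have hn2 : n ≠ 2 := fun h => hne (h ▸ rfl)
      have : (replicate n a).Sublist (replicate 1 a) := replicate_sublist_replicate a |>.2 (by omega)
      exact this.trans (by simp)

/-- A family of `n` distinct bit strings of length at most `s` has `n ≤ 3 ^ s`. -/
theorem card_le_three_pow_of_length_le {n s : ℕ} (f : Fin n → List Bool)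
    (hf : Function.Injective f) (hs : ∀ i, (f i).length ≤ s) : n ≤ 3 ^ s := by
  have hinj : Function.Injective fun (i : Fin n) (k : Fin s) => (f i)[(k : ℕ)]? := by
    intro i j hij
    refine hf (ext_getElem? fun k => ?_)
    rcases lt_or_ge k s with hk | hk
    · exact congrFun hij ⟨k, hk⟩
    · rw [getElem?_eq_none ((hs i).trans hk), getElem?_eq_none ((hs j).trans hk)]
  simpa using Fintype.card_le_of_injective _ hinj

theorem StreamingAlgorithm.run_append (M : StreamingAlgorithm α) (u v : List α) :
    M.run (u ++ v) = v.foldl M.update (M.run u) :=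
  foldl_append

/-- After reading `bᵖ a bᵏ` with `k < p`, the memory of an algorithm for the pattern `aa` and the
window size `p` determines `k`. -/
theorem SlidingWindowAlgorithm.SolvesPMAS.injective_run {A : SlidingWindowAlgorithm α}
    (hA : A.SolvesPMAS) {a b : α} (hab : a ≠ b) {p : ℕ} (hp : 2 ≤ p) :
    Function.Injective fun k : Fin p =>
      (A [a, a] p).run (replicate p b ++ a :: replicate (k : ℕ) b) := by
  have key : ∀ k j : ℕ, (A [a, a] p).answer ((replicate j b ++ [a]).foldl (A [a, a] p).update
      ((A [a, a] p).run (replicate p b ++ a :: replicate k b))) = true ↔ p < k + j + 2 := by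
    intro k j
    rw [← StreamingAlgorithm.run_append, append_assoc, cons_append, ← append_assoc (replicate k b),
      replicate_append_replicate, hA [a, a] p hp _ (by simp), isPMAS_pair_iff hab hp]
  intro k l hkl
  have hiff : ∀ j : ℕ, p < k + j + 2 ↔ p < l + j + 2 := fun j => by
    rw [← key, ← key]
    exact iff_of_eq (congrArg (fun x => (A [a, a] p).answer
      ((replicate j b ++ [a]).foldl (A [a, a] p).update x) = true) hkl)
  -- For `k ≤ p - 2` this is the largest `j` for which both `a`s still fit in a window; for `k = p -
  -- 1` it truncates to `0`, where they already do not fit.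
  have hk := hiff (p - 2 - k)
  have hl := hiff (p - 2 - l)
  ext
  omega

end BoundedRange

theorem mainTheorem12 {α : Type*} [Finite α] [Nontrivial α] :
    ¬ ∃ (A : BoundedRange.SlidingWindowAlgorithm α) (s : List α → ℕ → ℕ),
      A.SolvesPMAS ∧ A.UsesSpace s ∧
        ∀ v : List α, (fun p : ℕ => (s v p : ℝ)) =o[atTop] (fun p : ℕ => Real.log (p : ℝ)) := by
  rintro ⟨A, s, hA, hs, ho⟩
  obtain ⟨a, b, hab⟩ := exists_pair_ne α
  obtain ⟨p, hsmall, hp⟩ :=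
    (((ho [a, a]).def (show (0 : ℝ) < 1 / 3 by norm_num)).and (eventually_ge_atTop 2)).exists
  have hcard : p ≤ 3 ^ s [a, a] p :=
    BoundedRange.card_le_three_pow_of_length_le _ (hA.injective_run hab hp) fun _ => hs _ _ hp _
  have hlogp : 0 < Real.log p := Real.log_pos (by exact_mod_cast hp)
  have hlog : Real.log p ≤ s [a, a] p * Real.log 3 := by
    rw [← Real.log_pow]
    exact Real.log_le_log (by positivity) (by exact_mod_cast hcard)
  -- With the constant `1 / 3` this yields `log p ≤ 2 s ≤ (2 / 3) log p`, a contradiction.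
  have hlog3 : Real.log 3 ≤ 2 := by
    linarith [Real.log_le_sub_one_of_pos (show (0 : ℝ) < 3 by norm_num)]
  rw [Real.norm_of_nonneg (by positivity), Real.norm_of_nonneg hlogp.le] at hsmall
  have := mul_le_mul_of_nonneg_left hlog3 (Nat.cast_nonneg (α := ℝ) (s [a, a] p))
  linarith
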